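/- Let $d\ge 2$, and let $\Omega_0\subset\mathbb C$ be a bounded, simply connected (in particular non-empty and connected) open set with $C^2$ boundary. Let $\gamma_1,\dots,\gamma_d:\Omega_0\to\Omega_0$ be holomorphic maps which extend continuously to $\overline{\Omega_0}$ and satisfy $\overline{\gamma_j(\Omega_0)}\subset\Omega_0$ for all $j$, and let $G:\Omega_0\to\mathbb C$ be holomorphic with a continuous extension to $\overline{\Omega_0}$. For $N\ge 1$ let $\mathcal H_N=H^2(\Omega_0,\mathbb C^N)$ be the Bergman space of holomorphic maps $F:\Omega_0\to\mathbb C^N$ with $\int_{\Omega_0}\|F(z)\|^2\,dm(z)<\infty$, where $m$ is Lebesgue measure and $\|\cdot\|$ is the Hermitian norm on $\mathbb{C}^N$. Given $N\times N$ permutation matrices $U_1,\dots,U_d$, consider the (compact) operator on $\mathcal H_N$ $$\mathscr L_N(F)(z)=\sum_{j=1}^d e^{G(\gamma_j z)}\,U_jF(\gamma_j z).$$ Let $\mu_0(\mathscr L_N)\ge\mu_1(\mathscr L_N)\ge\cdots$ be the singular values of $\mathscr L_N$, i.e. the eigenvalues of $\sqrt{\mathscr L_N^*\mathscr L_N}$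 repeated according to multiplicity, and for $r>0$ set $$\mathcal N(r)=\#\{j\in\mathbb N:\ \mu_j(\mathscr L_N)\ge 1/r\}.$$ Let $\mathbb P_N$ denote probability when $U_1,\dots,U_d$ are chosen independently and uniformly among the $N\times N$ permutation matrices. Theorem 1.2. There exist constants $C_2>0$ and $r_0>0$, depending only on $d$, $\Omega_0$, $\gamma_1,\dots,\gamma_d$ and $G$, with the following property: for every $k\in\mathbb N$ there is $A_k>0$ such that for all $N\ge 1$, $$\mathbb P_N\left(C_2^{-1}N\le\mathcal N(r_0)\le C_2N\right)\ \ge\ 1-\frac{A_k}{N^k}.$$ -/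

import Mathlib

open MeasureTheory Set Filter Topology
open scoped ENNReal

/-! ### Vector-valued Bergman spaces -/

section Bergman

/-- Sub-mean-value inequality over discs. -/
theorem enorm_le_lintegral_ball {E : Type*} [NormedAddCommGroup E] [NormedSpace ℂ E]
    [CompleteSpace E] {δ : ℝ} (F : ℂ → E) (c : ℂ)
    (hF : DifferentiableOn ℂ F (Metric.ball c δ)) :
    (∫⁻ r in Ioo (0 : ℝ) δ, ENNReal.ofReal r) * (ENNReal.ofReal (2 * Real.pi) * ‖F c‖ₑ) ≤
      ∫⁻ z in Metric.ball c δ, ‖F z‖ₑ := by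
  have hpi := Real.pi_pos
  have hcont : ContinuousOn (fun w => ‖F (c + w)‖ₑ) (Metric.ball 0 δ) := by
    apply ContinuousOn.enorm
    refine hF.continuousOn.comp (by fun_prop) ?_
    intro w hw
    simpa [Metric.mem_ball, dist_eq_norm] using hw
  set h : ℂ → ℝ≥0∞ := (Metric.ball (0 : ℂ) δ).indicator (fun w => ‖F (c + w)‖ₑ) with hh
  have hmeas : Measurable h := by
    classical
    rw [hh, ← Set.piecewise_eq_indicator]
    exact hcont.measurable_piecewise continuousOn_const Metric.isOpen_ball.measurableSet
  have h1 : ∫⁻ z in Metric.ball c δ, ‖F z‖ₑ = ∫⁻ w, h w := by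
    rw [← lintegral_indicator Metric.isOpen_ball.measurableSet,
      ← lintegral_add_left_eq_self _ c]
    congr 1
    funext w
    simp only [hh, Set.indicator, Metric.mem_ball, dist_eq_norm]
    simp
  have hsymm : Measurable (fun p : ℝ × ℝ => (Complex.polarCoord.symm p : ℂ)) := by
    have : (fun p : ℝ × ℝ => (Complex.polarCoord.symm p : ℂ)) =
        fun p : ℝ × ℝ => (p.1 : ℂ) * ((Real.cos p.2 : ℂ) + (Real.sin p.2 : ℂ) * Complex.I) := by
      funext p
      rw [Complex.polarCoord_symm_apply]
    rw [this]
    exact Continuous.measurable (by fun_prop)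
  rw [h1, ← Complex.lintegral_comp_polarCoord_symm, polarCoord_target,
    Measure.volume_eq_prod, setLIntegral_prod]
  swap
  · simp only [smul_eq_mul]
    exact ((by fun_prop : Measurable fun p : ℝ × ℝ => ENNReal.ofReal p.1).mul
      (hmeas.comp hsymm)).aemeasurable
  rw [← lintegral_mul_const' _ _ (ENNReal.mul_ne_top ENNReal.ofReal_ne_top enorm_ne_top)]
  refine le_trans ?_ (lintegral_mono_set (s := Ioo 0 δ) Ioo_subset_Ioi_self)
  refine setLIntegral_mono' measurableSet_Ioo fun r hr => ?_
  simp only [smul_eq_mul]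
  rw [lintegral_const_mul' _ _ ENNReal.ofReal_ne_top]
  gcongr
  have hval : ∀ θ : ℝ, h (Complex.polarCoord.symm (r, θ)) = ‖F (circleMap c r θ)‖ₑ := by
    intro θ
    have e : (Complex.polarCoord.symm (r, θ) : ℂ) = r * Complex.exp (θ * Complex.I) := by
      rw [Complex.polarCoord_symm_apply, Complex.exp_mul_I]
      push_cast
      rfl
    rw [e, hh, Set.indicator_of_mem]
    · rfl
    · rw [mem_ball_zero_iff, norm_mul, Complex.norm_exp_ofReal_mul_I, Complex.norm_real,
        Real.norm_of_nonneg hr.1.le, mul_one]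
      exact hr.2
  simp only [hval]
  have hsub : Metric.closedBall c |r| ⊆ Metric.ball c δ :=
    Metric.closedBall_subset_ball (by rw [abs_of_pos hr.1]; exact hr.2)
  have hav : Real.circleAverage F c r = F c := by
    apply DiffContOnCl.circleAverage
    exact (hF.mono hsub).diffContOnCl_ball subset_rfl
  have hper : Function.Periodic (fun θ => F (circleMap c r θ)) (2 * Real.pi) := fun θ => by
    simp only
    rw [periodic_circleMap c r θ]
  have hint : (2 * Real.pi) • F c = ∫ θ in Ioo (-Real.pi) Real.pi, F (circleMap c r θ) := by
    rw [← hav, Real.circleAverage_def, smul_smul, mul_inv_cancel₀ (by positivity), one_smul,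
      ← integral_Ioc_eq_integral_Ioo, ← intervalIntegral.integral_of_le (by linarith)]
    have := hper.intervalIntegral_add_eq 0 (-Real.pi)
    rw [zero_add] at this
    rw [this]
    congr 1
    ring
  calc ENNReal.ofReal (2 * Real.pi) * ‖F c‖ₑ = ‖(2 * Real.pi) • F c‖ₑ := by
        rw [enorm_smul, Real.enorm_of_nonneg (by positivity)]
    _ ≤ _ := by rw [hint]; exact enorm_integral_le_lintegral_enorm _

/-- The vector space underlying the Bergman space `H²(Ω, E)`: holomorphic maps `F : Ω → E` with
`∫_Ω ‖F‖² dm < ∞`. A map on `Ω` is represented by its extension by `0` to all of `ℂ`. -/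
def bergmanSubmodule (Ω : TopologicalSpace.Opens ℂ) (E : Type*) [NormedAddCommGroup E]
    [InnerProductSpace ℂ E] : Submodule ℂ (ℂ → E) where
  carrier := {F | DifferentiableOn ℂ F Ω ∧ MemLp F 2 (volume.restrict (Ω : Set ℂ)) ∧
    ∀ z ∉ Ω, F z = 0}
  add_mem' := fun {F G} hF hG =>
    ⟨hF.1.add hG.1, hF.2.1.add hG.2.1, fun z hz => by simp [hF.2.2 z hz, hG.2.2 z hz]⟩
  zero_mem' := ⟨differentiableOn_const 0, MemLp.zero', fun _ _ => rfl⟩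
  smul_mem' := fun c F hF =>
    ⟨hF.1.const_smul c, hF.2.1.const_smul c, fun z hz => by simp [hF.2.2 z hz]⟩

/-- The Bergman space `H²(Ω, E)` of square-integrable holomorphic maps `Ω → E`. -/
def BergmanSpace (Ω : TopologicalSpace.Opens ℂ) (E : Type*) [NormedAddCommGroup E]
    [InnerProductSpace ℂ E] : Type _ :=
  ↥(bergmanSubmodule Ω E)

namespace BergmanSpace

variable {Ω : TopologicalSpace.Opens ℂ} {E : Type*} [NormedAddCommGroup E] [InnerProductSpace ℂ E]

noncomputable instance : AddCommGroup (BergmanSpace Ω E) :=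
  inferInstanceAs (AddCommGroup ↥(bergmanSubmodule Ω E))

noncomputable instance : Module ℂ (BergmanSpace Ω E) :=
  inferInstanceAs (Module ℂ ↥(bergmanSubmodule Ω E))

instance : CoeFun (BergmanSpace Ω E) (fun _ => ℂ → E) := ⟨fun F => F.1⟩

@[ext] theorem ext {F G : BergmanSpace Ω E} (h : ∀ z ∈ Ω, F z = G z) : F = G := by
  apply Subtype.ext
  funext z
  by_cases hz : z ∈ Ω
  · exact h z hz
  · rw [F.2.2.2 z hz, G.2.2.2 z hz]

theorem add_apply (F G : BergmanSpace Ω E) (z : ℂ) : (F + G) z = F z + G z := rfl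
theorem sub_apply (F G : BergmanSpace Ω E) (z : ℂ) : (F - G) z = F z - G z := rfl
theorem smul_apply (c : ℂ) (F : BergmanSpace Ω E) (z : ℂ) : (c • F) z = c • F z := rfl

theorem differentiableOn (F : BergmanSpace Ω E) : DifferentiableOn ℂ F Ω := F.2.1

theorem memLp (F : BergmanSpace Ω E) : MemLp F 2 (volume.restrict (Ω : Set ℂ)) := F.2.2.1

/-- The class in `L²(Ω, E)` of an element of the Bergman space. -/
noncomputable def toL2 (F : BergmanSpace Ω E) : Lp E 2 (volume.restrict (Ω : Set ℂ)) :=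
  F.memLp.toLp F

theorem toL2_add (F G : BergmanSpace Ω E) : toL2 (F + G) = toL2 F + toL2 G :=
  MemLp.toLp_add F.memLp G.memLp

theorem toL2_sub (F G : BergmanSpace Ω E) : toL2 (F - G) = toL2 F - toL2 G :=
  MemLp.toLp_sub F.memLp G.memLp

theorem toL2_smul (c : ℂ) (F : BergmanSpace Ω E) : toL2 (c • F) = c • toL2 F :=
  MemLp.toLp_const_smul c F.memLp

theorem eq_zero_of_toL2_eq_zero {F : BergmanSpace Ω E} (h : toL2 F = 0) : F = 0 := by
  have h1 : (F : ℂ → E) =ᵐ[volume.restrict (Ω : Set ℂ)] fun _ => (0 : E) :=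
    (F.memLp.coeFn_toLp).symm.trans (by
      change (toL2 F : ℂ → E) =ᵐ[_] _
      rw [h]; exact Lp.coeFn_zero E 2 _)
  have h2 := Measure.eqOn_open_of_ae_eq h1 Ω.isOpen F.differentiableOn.continuousOn
    continuousOn_const
  exact ext fun z hz => h2 hz

/-- The inner product `⟪F, G⟫ = ∫_Ω ⟪F z, G z⟫ dm(z)`, conjugate-linear in the first variable. -/
noncomputable instance : Inner ℂ (BergmanSpace Ω E) :=
  ⟨fun F G => ∫ z in (Ω : Set ℂ), inner ℂ (F z) (G z)⟩

theorem inner_def (F G : BergmanSpace Ω E) :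
    inner ℂ F G = ∫ z in (Ω : Set ℂ), inner ℂ (F z) (G z) := rfl

theorem inner_eq_toL2 (F G : BergmanSpace Ω E) : inner ℂ F G = inner ℂ (toL2 F) (toL2 G) := by
  rw [inner_def, L2.inner_def]
  apply integral_congr_ae
  filter_upwards [F.memLp.coeFn_toLp, G.memLp.coeFn_toLp] with z h1 h2
  simp only [toL2]
  rw [h1, h2]

/-- The integral inner product is positive definite. -/
noncomputable abbrev core : InnerProductSpace.Core ℂ (BergmanSpace Ω E) where
  inner := fun F G => inner ℂ F G
  conj_inner_symm F G := by simp only [inner_eq_toL2]; exact inner_conj_symm _ _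
  re_inner_nonneg F := by simp only [inner_eq_toL2]; exact inner_self_nonneg
  add_left F G K := by simp only [inner_eq_toL2, toL2_add]; exact inner_add_left _ _ _
  smul_left F G c := by simp only [inner_eq_toL2, toL2_smul]; exact inner_smul_left _ _ _
  definite F h := by
    simp only [inner_eq_toL2] at h
    exact eq_zero_of_toL2_eq_zero (inner_self_eq_zero.1 h)

/-- The norm `‖F‖ = (∫_Ω ‖F z‖² dm(z))^{1/2}`. -/
noncomputable instance : NormedAddCommGroup (BergmanSpace Ω E) :=
  InnerProductSpace.Core.toNormedAddCommGroup (cd := core)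

noncomputable instance : InnerProductSpace ℂ (BergmanSpace Ω E) :=
  InnerProductSpace.ofCore core.toCore

theorem norm_toL2 (F : BergmanSpace Ω E) : ‖toL2 F‖ = ‖F‖ := by
  rw [@norm_eq_sqrt_re_inner ℂ, @norm_eq_sqrt_re_inner ℂ _ _ _ _ F, ← inner_eq_toL2]

theorem norm_eq (F : BergmanSpace Ω E) :
    ‖F‖ = (eLpNorm F 2 (volume.restrict (Ω : Set ℂ))).toReal := by
  rw [← norm_toL2, toL2, Lp.norm_toLp]

theorem cauchySeq_toL2 {u : ℕ → BergmanSpace Ω E} (hu : CauchySeq u) :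
    CauchySeq fun n => toL2 (u n) := by
  rw [Metric.cauchySeq_iff] at hu ⊢
  intro ε hε
  obtain ⟨n, hn⟩ := hu ε hε
  refine ⟨n, fun p hp q hq => ?_⟩
  rw [dist_eq_norm, ← toL2_sub, norm_toL2, ← dist_eq_norm]
  exact hn p hp q hq

variable [CompleteSpace E]

/-- Point evaluations on the Bergman space are bounded, locally uniformly on `Ω`. -/
theorem exists_bound {K : Set ℂ} (hK : IsCompact K) (hKΩ : K ⊆ Ω) :
    ∃ C : ℝ, 0 ≤ C ∧ ∀ F : BergmanSpace Ω E, ∀ z ∈ K, ‖F z‖ ≤ C * ‖F‖ := by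
  obtain ⟨δ, hδ, hδK⟩ := hK.exists_cthickening_subset_open Ω.isOpen hKΩ
  have hball : ∀ z ∈ K, Metric.ball z δ ⊆ Ω := fun z hz =>
    (Metric.ball_subset_closedBall.trans (Metric.closedBall_subset_cthickening hz δ)).trans hδK
  set κ : ℝ≥0∞ := ∫⁻ r in Ioo (0 : ℝ) δ, ENNReal.ofReal r with hκ
  have hκ0 : κ ≠ 0 := by
    rw [hκ, Ne, lintegral_eq_zero_iff (by fun_prop)]
    intro h
    rw [Filter.EventuallyEq, ae_restrict_iff' measurableSet_Ioo] at h
    have : volume (Ioo (0 : ℝ) δ) = 0 := by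
      refine measure_mono_null ?_ (ae_iff.1 h)
      intro r hr
      simp only [mem_ofPred_eq, Pi.zero_apply, Classical.not_imp, ENNReal.ofReal_eq_zero, not_le]
      exact ⟨hr, hr.1⟩
    simp at this
    linarith
  set a : ℝ≥0∞ := κ * ENNReal.ofReal (2 * Real.pi) with ha
  have ha0 : a ≠ 0 := mul_ne_zero hκ0 (by simp [Real.pi_pos])
  set v : ℝ≥0∞ := (volume (Metric.ball (0 : ℂ) δ)) ^ (1 / 2 : ℝ) with hv
  have hv1 : v ≠ ∞ := ENNReal.rpow_ne_top_of_nonneg (by norm_num) measure_ball_lt_top.ne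
  refine ⟨(a⁻¹ * v).toReal, ENNReal.toReal_nonneg, fun F z hz => ?_⟩
  have key : a * ‖F z‖ₑ ≤ eLpNorm F 2 (volume.restrict (Ω : Set ℂ)) * v := by
    calc a * ‖F z‖ₑ ≤ ∫⁻ w in Metric.ball z δ, ‖F w‖ₑ := by
          rw [ha, mul_assoc]
          exact enorm_le_lintegral_ball F z (F.differentiableOn.mono (hball z hz))
      _ = eLpNorm F 1 (volume.restrict (Metric.ball z δ)) := by
          rw [eLpNorm_one_eq_lintegral_enorm]
      _ ≤ eLpNorm F 2 (volume.restrict (Metric.ball z δ)) * v := by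
          refine (eLpNorm_le_eLpNorm_mul_rpow_measure_univ (q := 2) one_le_two
            (F.memLp.1.mono_measure (Measure.restrict_mono (hball z hz) le_rfl))).trans_eq ?_
          rw [Measure.restrict_apply_univ, hv, Complex.volume_ball, Complex.volume_ball]
          norm_num
      _ ≤ _ := by
          gcongr
          exact hball z hz
  have h2 : ‖F z‖ₑ ≤ (a⁻¹ * v) * eLpNorm F 2 (volume.restrict (Ω : Set ℂ)) := by
    by_cases hatop : a = ∞
    · rw [hatop] at key
      have hfin : eLpNorm F 2 (volume.restrict (Ω : Set ℂ)) * v < ∞ :=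
        ENNReal.mul_lt_top F.memLp.2 hv1.lt_top
      have : ‖F z‖ₑ = 0 := by
        by_contra h0
        rw [ENNReal.top_mul h0] at key
        exact absurd hfin (not_lt.2 key)
      rw [this]; exact zero_le
    · rw [mul_assoc, mul_comm v, ← ENNReal.div_eq_inv_mul, ENNReal.le_div_iff_mul_le (Or.inl ha0)
        (Or.inl hatop), mul_comm]
      exact key
  rw [norm_eq, ← ENNReal.toReal_mul, ← toReal_enorm]
  refine ENNReal.toReal_mono ?_ h2
  exact ENNReal.mul_ne_top (ENNReal.mul_ne_top (ENNReal.inv_ne_top.2 ha0) hv1) F.memLp.2.ne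

instance : CompleteSpace (BergmanSpace Ω E) := by
  refine Metric.complete_of_cauchySeq_tendsto fun u hu => ?_
  obtain ⟨f, hf⟩ := cauchySeq_tendsto_of_complete (cauchySeq_toL2 hu)
  have hunif : ∀ K ⊆ (Ω : Set ℂ), IsCompact K →
      UniformCauchySeqOn (fun n z => u n z) atTop K := by
    intro K hK hKc
    obtain ⟨C, hC0, hC⟩ := exists_bound (E := E) hKc hK
    rw [Metric.uniformCauchySeqOn_iff]
    intro ε hε
    obtain ⟨n, hn⟩ := Metric.cauchySeq_iff.1 hu (ε / (C + 1)) (by positivity)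
    refine ⟨n, fun p hp q hq z hz => ?_⟩
    have h1 := hn p hp q hq
    rw [dist_eq_norm] at h1 ⊢
    rw [← sub_apply]
    calc ‖(u p - u q) z‖ ≤ C * ‖u p - u q‖ := hC _ z hz
      _ ≤ (C + 1) * ‖u p - u q‖ := by gcongr; linarith
      _ < (C + 1) * (ε / (C + 1)) := by gcongr
      _ = ε := by field_simp
  have hpt : ∀ z, ∃ y, Tendsto (fun n => u n z) atTop (𝓝 y) ∧ (z ∉ Ω → y = 0) := by
    intro z
    by_cases hz : z ∈ Ω
    · obtain ⟨y, hy⟩ := cauchySeq_tendsto_of_complete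
        ((hunif {z} (by simpa using hz) isCompact_singleton).cauchySeq (mem_singleton z))
      exact ⟨y, hy, fun h => absurd hz h⟩
    · refine ⟨0, ?_, fun _ => rfl⟩
      have : (fun n => u n z) = fun _ => (0 : E) := funext fun n => (u n).2.2.2 z hz
      rw [this]; exact tendsto_const_nhds
  choose g hg hg0 using hpt
  have hloc : TendstoLocallyUniformlyOn (fun n z => u n z) g atTop (Ω : Set ℂ) := by
    rw [tendstoLocallyUniformlyOn_iff_forall_isCompact Ω.isOpen]
    intro K hK hKc
    exact (hunif K hK hKc).tendstoUniformlyOn_of_tendsto fun z _ => hg z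
  have hdiff : DifferentiableOn ℂ g Ω :=
    hloc.differentiableOn (Eventually.of_forall fun n => (u n).differentiableOn) Ω.isOpen
  have hae : (f : ℂ → E) =ᵐ[volume.restrict (Ω : Set ℂ)] g := by
    obtain ⟨ns, hns, hlim⟩ := (tendstoInMeasure_of_tendsto_Lp hf).exists_seq_tendsto_ae
    have hall : ∀ᵐ z ∂(volume.restrict (Ω : Set ℂ)), ∀ i, (toL2 (u (ns i)) : ℂ → E) z = u (ns i) z :=
      ae_all_iff.2 fun i => (u (ns i)).memLp.coeFn_toLp
    filter_upwards [hlim, hall] with z h1 h2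
    simp only [h2] at h1
    exact tendsto_nhds_unique h1 ((hg z).comp hns.tendsto_atTop)
  have hmem : MemLp g 2 (volume.restrict (Ω : Set ℂ)) := (memLp_congr_ae hae).1 (Lp.memLp f)
  let F : BergmanSpace Ω E := ⟨g, hdiff, hmem, hg0⟩
  have hF : toL2 F = f := by
    apply Lp.ext
    exact (hmem.coeFn_toLp).trans hae.symm
  refine ⟨F, ?_⟩
  rw [tendsto_iff_norm_sub_tendsto_zero] at hf ⊢
  refine hf.congr fun n => ?_
  rw [← hF, ← toL2_sub, norm_toL2]

end BergmanSpace

end Bergman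

/-! ### Singular values of compact operators -/

section SingularValues

variable {H : Type*} [NormedAddCommGroup H] [InnerProductSpace ℂ H] [CompleteSpace H]

/-- The `j`-th singular value (`j = 0, 1, 2, …`) `μ_j(T)` of a compact operator `T`, i.e. the
`j`-th term of the decreasing sequence of the eigenvalues of `|T| = √(T* T)`, repeated according to
multiplicity (and continued by `0` if `T` has finite rank): it is the largest `t > 0` such that `|T|`
has at least `j + 1` eigenvalues in `[t, ∞)`, counted with multiplicity. -/
noncomputable def singularValue (T : H →L[ℂ] H) (j : ℕ) : ℝ :=
  sSup {t : ℝ | 0 < t ∧ (j : Cardinal) <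
    Module.rank ℂ ↥(⨆ s : Ici t, Module.End.eigenspace
      (CFC.sqrt (star T * T)).toLinearMap ((s : ℝ) : ℂ))}

/-- The counting function `𝒩(r) = #{j ∈ ℕ : μ_j(T) ≥ 1/r}`. -/
noncomputable def singularValueCount (T : H →L[ℂ] H) (r : ℝ) : ℕ∞ :=
  {j : ℕ | 1 / r ≤ singularValue T j}.encard

end SingularValues

/-! ### Twisted transfer operators -/

/-- An open set `U ⊆ ℂ` has `C²` boundary: near each boundary point `p` it is the sublevel set
`{ρ < 0}` of a real `C²` function `ρ` with nonzero differential at `p`. -/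
def HasC2Boundary (U : Set ℂ) : Prop :=
  ∀ p ∈ frontier U, ∃ V : Set ℂ, IsOpen V ∧ p ∈ V ∧ ∃ ρ : ℂ → ℝ,
    ContDiffOn ℝ 2 ρ V ∧ fderiv ℝ ρ p ≠ 0 ∧ U ∩ V = {z ∈ V | ρ z < 0}

/-- The data `(Ω, γ_1, …, γ_d, G)`. Maps on `Ω` which extend continuously to the closure of
`Ω` are given as maps on `ℂ`, of which only the values on the closure of `Ω` matter; `DiffContOnCl`
means holomorphic on `Ω` and continuous on the closure of `Ω`. -/
structure TransferSystem (d : ℕ) where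
  /-- the domain -/
  Ω : TopologicalSpace.Opens ℂ
  isBounded : Bornology.IsBounded (Ω : Set ℂ)
  isSimplyConnected : IsSimplyConnected (Ω : Set ℂ)
  hasC2Boundary : HasC2Boundary (Ω : Set ℂ)
  /-- the contractions -/
  γ : Fin d → ℂ → ℂ
  γ_diffContOnCl : ∀ j, DiffContOnCl ℂ (γ j) (Ω : Set ℂ)
  closure_image_subset : ∀ j, closure (γ j '' (Ω : Set ℂ)) ⊆ Ω
  /-- the weight -/
  G : ℂ → ℂ
  G_diffContOnCl : DiffContOnCl ℂ G (Ω : Set ℂ)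

namespace TransferSystem

variable {d : ℕ} (S : TransferSystem d) {N : ℕ}

/-- The Bergman space `ℋ_N = H²(Ω, ℂ^N)`. -/
abbrev Hilb (N : ℕ) : Type := BergmanSpace S.Ω (EuclideanSpace ℂ (Fin N))

/-- `(ℒ_N F)(z) = ∑_j e^{G(γ_j z)} U_j F(γ_j z)`, with `U_j` the permutation matrix of `σ j`. -/
noncomputable def transferFun (σ : Fin d → Equiv.Perm (Fin N))
    (F : ℂ → EuclideanSpace ℂ (Fin N)) (z : ℂ) : EuclideanSpace ℂ (Fin N) :=
  ∑ j, Complex.exp (S.G (S.γ j z)) •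
    Matrix.toEuclideanCLM (𝕜 := ℂ) ((σ j).permMatrix ℂ) (F (S.γ j z))

theorem mapsTo (j : Fin d) : MapsTo (S.γ j) S.Ω S.Ω := fun _ hz =>
  S.closure_image_subset j (subset_closure (mem_image_of_mem _ hz))

theorem isCompact_closure_image (j : Fin d) : IsCompact (closure (S.γ j '' (S.Ω : Set ℂ))) :=
  (S.isBounded.subset (image_subset_iff.2 (S.mapsTo j))).isCompact_closure

theorem volume_lt_top : volume (S.Ω : Set ℂ) < ∞ := S.isBounded.measure_lt_top

theorem transferFun_differentiableOn (σ : Fin d → Equiv.Perm (Fin N)) (F : S.Hilb N) :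
    DifferentiableOn ℂ (S.transferFun σ F) S.Ω := by
  unfold transferFun
  refine DifferentiableOn.fun_sum fun j _ => ?_
  have hγ := (S.γ_diffContOnCl j).differentiableOn
  refine DifferentiableOn.fun_smul ?_ ?_
  · exact (S.G_diffContOnCl.differentiableOn.comp hγ (S.mapsTo j)).cexp
  · exact (ContinuousLinearMap.differentiable _).comp_differentiableOn
      (F.differentiableOn.comp hγ (S.mapsTo j))

theorem transferFun_bound (σ : Fin d → Equiv.Perm (Fin N)) :
    ∃ D : ℝ, 0 ≤ D ∧ ∀ F : S.Hilb N, ∀ z ∈ S.Ω, ‖S.transferFun σ F z‖ ≤ D * ‖F‖ := by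
  have h1 : ∀ j, ∃ C : ℝ, 0 ≤ C ∧ ∀ F : S.Hilb N, ∀ z ∈ closure (S.γ j '' (S.Ω : Set ℂ)),
      ‖F z‖ ≤ C * ‖F‖ := fun j =>
    BergmanSpace.exists_bound (S.isCompact_closure_image j) (S.closure_image_subset j)
  have h2 : ∀ j, ∃ M : ℝ, ∀ z ∈ closure (S.γ j '' (S.Ω : Set ℂ)),
      ‖Complex.exp (S.G z)‖ ≤ M := fun j =>
    (S.isCompact_closure_image j).exists_bound_of_continuousOn
      ((S.G_diffContOnCl.differentiableOn.continuousOn.mono (S.closure_image_subset j)).cexp)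
  choose C hC0 hC using h1
  choose M hM using h2
  refine ⟨∑ j, |M j| * (‖Matrix.toEuclideanCLM (𝕜 := ℂ) ((σ j).permMatrix ℂ)‖ * C j),
    Finset.sum_nonneg fun j _ => mul_nonneg (abs_nonneg _) (mul_nonneg (norm_nonneg _) (hC0 j)),
    fun F z hz => ?_⟩
  rw [Finset.sum_mul]
  refine norm_sum_le_of_le _ fun j _ => ?_
  have hz' : S.γ j z ∈ closure (S.γ j '' (S.Ω : Set ℂ)) :=
    subset_closure (mem_image_of_mem _ hz)
  rw [norm_smul, mul_assoc, mul_assoc]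
  refine mul_le_mul ((hM j _ hz').trans (le_abs_self _)) ?_ (norm_nonneg _) (abs_nonneg _)
  refine (ContinuousLinearMap.le_opNorm _ _).trans ?_
  exact mul_le_mul_of_nonneg_left (hC j F _ hz') (norm_nonneg _)

theorem eLpNorm_transferFun_le (σ : Fin d → Equiv.Perm (Fin N)) :
    ∃ D : ℝ, 0 ≤ D ∧ ∀ F : S.Hilb N,
      eLpNorm (S.transferFun σ F) 2 (volume.restrict (S.Ω : Set ℂ)) ≤
        ENNReal.ofReal (D * ‖F‖) := by
  obtain ⟨D, hD0, hD⟩ := S.transferFun_bound σ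
  have hv : volume (S.Ω : Set ℂ) ^ (2 : ℝ≥0∞).toReal⁻¹ ≠ ∞ :=
    ENNReal.rpow_ne_top_of_nonneg (by positivity) S.volume_lt_top.ne
  refine ⟨(volume (S.Ω : Set ℂ) ^ (2 : ℝ≥0∞).toReal⁻¹).toReal * D,
    mul_nonneg ENNReal.toReal_nonneg hD0, fun F => ?_⟩
  have h := eLpNorm_le_of_ae_bound (p := 2) (f := S.transferFun σ F)
    (μ := volume.restrict (S.Ω : Set ℂ)) (C := D * ‖F‖)
    ((ae_restrict_iff' S.Ω.isOpen.measurableSet).2 (Eventually.of_forall fun z hz => hD F z hz))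
  rw [Measure.restrict_apply_univ] at h
  rw [mul_assoc, ENNReal.ofReal_mul ENNReal.toReal_nonneg, ENNReal.ofReal_toReal hv]
  exact h

theorem indicator_ae_eq (f : ℂ → EuclideanSpace ℂ (Fin N)) :
    (S.Ω : Set ℂ).indicator f =ᵐ[volume.restrict (S.Ω : Set ℂ)] f :=
  indicator_ae_eq_restrict S.Ω.isOpen.measurableSet

theorem indicator_transferFun_mem (σ : Fin d → Equiv.Perm (Fin N)) (F : S.Hilb N) :
    (S.Ω : Set ℂ).indicator (S.transferFun σ F) ∈
      bergmanSubmodule S.Ω (EuclideanSpace ℂ (Fin N)) := by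
  obtain ⟨D, -, hD⟩ := S.eLpNorm_transferFun_le σ
  refine ⟨(S.transferFun_differentiableOn σ F).congr fun z hz => indicator_of_mem hz _, ?_,
    fun z hz => indicator_of_notMem hz _⟩
  refine (memLp_congr_ae (S.indicator_ae_eq _)).2 ⟨?_, (hD F).trans_lt ENNReal.ofReal_lt_top⟩
  exact (S.transferFun_differentiableOn σ F).continuousOn.aestronglyMeasurable
    S.Ω.isOpen.measurableSet

/-- The twisted transfer operator `ℒ_N` as a bounded operator on `ℋ_N = H²(Ω, ℂ^N)`. -/
noncomputable def transferOperator (σ : Fin d → Equiv.Perm (Fin N)) :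
    S.Hilb N →L[ℂ] S.Hilb N :=
  LinearMap.mkContinuousOfExistsBound
    { toFun := fun F => ⟨(S.Ω : Set ℂ).indicator (S.transferFun σ F),
        S.indicator_transferFun_mem σ F⟩
      map_add' := fun F K => by
        apply BergmanSpace.ext
        intro z hz
        have hz' : z ∈ (S.Ω : Set ℂ) := hz
        change (S.Ω : Set ℂ).indicator (S.transferFun σ (F + K : S.Hilb N)) z =
          (S.Ω : Set ℂ).indicator (S.transferFun σ F) z +
            (S.Ω : Set ℂ).indicator (S.transferFun σ K) z
        simp only [BergmanSpace.add_apply, indicator_of_mem hz', transferFun, map_add, smul_add,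
          Finset.sum_add_distrib]
      map_smul' := fun c F => by
        apply BergmanSpace.ext
        intro z hz
        have hz' : z ∈ (S.Ω : Set ℂ) := hz
        change (S.Ω : Set ℂ).indicator (S.transferFun σ (c • F : S.Hilb N)) z =
          c • (S.Ω : Set ℂ).indicator (S.transferFun σ F) z
        simp only [BergmanSpace.smul_apply, indicator_of_mem hz', transferFun, map_smul,
          Finset.smul_sum]
        exact Finset.sum_congr rfl fun j _ => smul_comm _ _ _ }
    (by
      obtain ⟨D, hD0, hD⟩ := S.eLpNorm_transferFun_le σ
      refine ⟨D, fun F => ?_⟩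
      rw [BergmanSpace.norm_eq]
      refine ENNReal.toReal_le_of_le_ofReal (mul_nonneg hD0 (norm_nonneg _)) ?_
      exact (eLpNorm_congr_ae (S.indicator_ae_eq _)).trans_le (hD F))

theorem transferOperator_apply (σ : Fin d → Equiv.Perm (Fin N)) (F : S.Hilb N) {z : ℂ}
    (hz : z ∈ S.Ω) :
    S.transferOperator σ F z = ∑ j, Complex.exp (S.G (S.γ j z)) •
      Matrix.toEuclideanCLM (𝕜 := ℂ) ((σ j).permMatrix ℂ) (F (S.γ j z)) :=
  indicator_of_mem (s := (S.Ω : Set ℂ)) hz _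

end TransferSystem

/-- The probability `ℙ_N` of an event for `d` independent, uniformly distributed permutations of
`N` letters, i.e. the uniform probability on the finite set of `d`-tuples of permutations. -/
noncomputable def permProb {d N : ℕ} (A : Set (Fin d → Equiv.Perm (Fin N))) : ℝ :=
  (A.ncard : ℝ) / Fintype.card (Fin d → Equiv.Perm (Fin N))

/-! ### Counting singular values through subspaces -/

section SpectralTools

variable {H : Type*} [NormedAddCommGroup H] [InnerProductSpace ℂ H]

/-! No randomness is needed: both bounds hold for every choice of permutations, with constants
independent of `N`, so the event has probability one. Singular values are counted by a min-max
principle: smallness of `‖T x‖` in finite codimension bounds the count above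
(`singularValueCount_le_of_ker`), and a lower bound for `‖T x‖` on a finite-dimensional subspace
bounds it below (`le_singularValueCount`).

Upper bound: `ℒ_N F` only involves values of `F` on the compact set `K ⊆ Ω`, the union of the
closures of the images `γ_j(Ω)`. Bergman functions are Lipschitz near `K` with a constant
independent of `N`, so if `F` vanishes on a fine finite net of `m` points of `K`, then `ℒ_N F` is
small. Vanishing at `m` points has codimension at most `m N`.

Lower bound: fix `z ∈ Ω` and a polynomial `f` equal to 1 at `γ_{j₀} z` and to 0 at the other points
`γ_j z`. Then `ℒ_N (f u)(z)` is a nonzero scalar times a sum of `U_j u` over the `j` with `γ_j z =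
γ_{j₀} z`. Cancellation in this sum is avoided by supporting `u` on `σ_{j₀}(I)`, where distinct
letters of `I` have disjoint sets of images. A largest such `I` has at least `N / d²` letters, and
`u ↦ f u` gives the subspace required. -/

theorem LinearMap.IsSymmetric.exists_norm_sq_eq_sum {A : H →ₗ[ℂ] H} (hA : A.IsSymmetric)
    {ι : Type*} {f : ι → ℂ} (hf : Function.Injective f) {x : H}
    (hx : x ∈ ⨆ i, Module.End.eigenspace A (f i)) :
    ∃ (s : Finset ι) (y : ∀ i, Module.End.eigenspace A (f i)),
      ‖x‖ ^ 2 = ∑ i ∈ s, ‖y i‖ ^ 2 ∧ ‖A x‖ ^ 2 = ∑ i ∈ s, ‖f i‖ ^ 2 * ‖y i‖ ^ 2 := by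
  classical
  obtain ⟨y, rfl⟩ := (Submodule.mem_iSup_iff_exists_dfinsupp' _ x).1 hx
  have hV := (hA.orthogonalFamily_eigenspaces).comp hf
  refine ⟨y.support, fun i => y i, ?_, ?_⟩
  · exact hV.norm_sum (fun i => y i) y.support
  · have h1 : A (y.sum fun _ xi => (xi : H)) =
        ∑ i ∈ y.support, ((f i • y i : Module.End.eigenspace A (f i)) : H) := by
      rw [DFinsupp.sum, map_sum]
      exact Finset.sum_congr rfl fun i _ => Module.End.mem_eigenspace_iff.1 (y i).2
    rw [h1]
    refine (hV.norm_sum (fun i => f i • y i) y.support).trans ?_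
    exact Finset.sum_congr rfl fun i _ => by rw [norm_smul, mul_pow]

theorem LinearMap.IsSymmetric.mul_norm_le_of_mem_iSup_eigenspace {A : H →ₗ[ℂ] H}
    (hA : A.IsSymmetric) {t : ℝ} (ht : 0 ≤ t) {x : H}
    (hx : x ∈ ⨆ s : Ici t, Module.End.eigenspace A ((s : ℝ) : ℂ)) : t * ‖x‖ ≤ ‖A x‖ := by
  obtain ⟨s, y, h1, h2⟩ := hA.exists_norm_sq_eq_sum
    (f := fun s : Ici t => ((s : ℝ) : ℂ))
    (Complex.ofReal_injective.comp Subtype.coe_injective) hx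
  refine le_of_sq_le_sq ?_ (norm_nonneg _)
  rw [mul_pow, h1, h2, Finset.mul_sum]
  refine Finset.sum_le_sum fun i _ => ?_
  have hi : t ≤ (i : ℝ) := i.2
  have : t ≤ ‖((i : ℝ) : ℂ)‖ := by
    rw [Complex.norm_real]; exact hi.trans (le_abs_self _)
  gcongr

/-- Orthogonality of eigenspaces reduces this to single components; indices whose `f i` is not an
eigenvalue contribute zero, so `f` may run over many irrelevant numbers. -/
theorem LinearMap.IsSymmetric.norm_le_of_mem_iSup_eigenspace {A : H →ₗ[ℂ] H}
    (hA : A.IsSymmetric) {ι : Type*} {f : ι → ℂ} (hf : Function.Injective f) {t : ℝ} (ht : 0 ≤ t)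
    (hft : ∀ i, Module.End.HasEigenvalue A (f i) → ‖f i‖ ≤ t) {x : H}
    (hx : x ∈ ⨆ i, Module.End.eigenspace A (f i)) : ‖A x‖ ≤ t * ‖x‖ := by
  obtain ⟨s, y, h1, h2⟩ := hA.exists_norm_sq_eq_sum hf hx
  refine le_of_sq_le_sq ?_ (by positivity)
  rw [mul_pow, h1, h2, Finset.mul_sum]
  refine Finset.sum_le_sum fun i _ => ?_
  by_cases hi : Module.End.HasEigenvalue A (f i)
  · have := hft i hi
    gcongr
  · have : y i = 0 := by
      have h0 : Module.End.eigenspace A (f i) = ⊥ := by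
        simpa [Module.End.hasEigenvalue_iff] using hi
      exact Subtype.ext ((Submodule.mem_bot ℂ).1 (h0.le (y i).2))
    simp [this]

variable [CompleteSpace H]

/-- On the orthogonal complement of its eigenvectors with eigenvalue at least `t`, a compact
positive operator is bounded by `t`. -/
theorem ContinuousLinearMap.IsPositive.norm_le_of_mem_orthogonal {A : H →L[ℂ] H}
    (hA : A.IsPositive) (hc : IsCompactOperator A) {t : ℝ} (ht : 0 ≤ t) {x : H}
    (hx : x ∈ (⨆ s : Ici t, Module.End.eigenspace A.toLinearMap ((s : ℝ) : ℂ))ᗮ) :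
    ‖A x‖ ≤ t * ‖x‖ := by
  have hsym : A.toLinearMap.IsSymmetric := hA.isSymmetric
  set U := ⨆ s : Ici t, Module.End.eigenspace A.toLinearMap ((s : ℝ) : ℂ) with hU
  -- `L` collects the eigenvectors left out of `U`. By the spectral theorem `L ⊔ U` is dense, so
  -- `Uᗮ` lies in the closure of `L`, where the eigenvalues are in `[0, t)`.
  set f : {μ : ℂ // ∀ s : Ici t, μ ≠ ((s : ℝ) : ℂ)} → ℂ := Subtype.val with hf
  set L := ⨆ i, Module.End.eigenspace A.toLinearMap (f i) with hL
  have hLU : L ⟂ U := by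
    rw [hL, hU, Submodule.isOrtho_iSup_left]
    intro i
    rw [Submodule.isOrtho_iSup_right]
    intro s
    rw [Submodule.isOrtho_iff_inner_eq]
    intro u hu v hv
    exact hsym.orthogonalFamily_eigenspaces (i.2 s) ⟨u, hu⟩ ⟨v, hv⟩
  have hsup : (⨆ μ, Module.End.eigenspace A.toLinearMap μ) ≤ L ⊔ U := by
    refine iSup_le fun μ => ?_
    by_cases h : ∀ s : Ici t, μ ≠ ((s : ℝ) : ℂ)
    · exact (le_iSup (fun i => Module.End.eigenspace A.toLinearMap (f i)) ⟨μ, h⟩).trans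
        le_sup_left
    · push Not at h
      obtain ⟨s, rfl⟩ := h
      exact (le_iSup (fun s : Ici t => Module.End.eigenspace A.toLinearMap ((s : ℝ) : ℂ)) s).trans
        le_sup_right
  have hbot : Lᗮ ⊓ Uᗮ = ⊥ := by
    rw [Submodule.inf_orthogonal, eq_bot_iff,
      ← A.orthogonalComplement_iSup_eigenspaces_eq_bot hc hsym]
    exact Submodule.orthogonal_le hsup
  have hxL : x ∈ L.topologicalClosure := by
    have hLc : CompleteSpace L.topologicalClosure :=
      (Submodule.isClosed_topologicalClosure L).completeSpace_coe
    obtain ⟨p, hp, q, hq, rfl⟩ := L.topologicalClosure.exists_add_mem_mem_orthogonal x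
    rw [Submodule.orthogonal_closure] at hq
    have hpU : p ∈ Uᗮ := by
      have : L.topologicalClosure ≤ Uᗮ :=
        Submodule.topologicalClosure_minimal _ hLU (Submodule.isClosed_orthogonal U)
      exact this hp
    have hqU : q ∈ Uᗮ := by simpa using Uᗮ.sub_mem hx hpU
    have : q ∈ Lᗮ ⊓ Uᗮ := ⟨hq, hqU⟩
    rw [hbot, Submodule.mem_bot] at this
    rw [this, add_zero]
    exact hp
  have hclosed : IsClosed {x : H | ‖A x‖ ≤ t * ‖x‖} :=
    isClosed_le (by fun_prop) (by fun_prop)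
  refine closure_minimal (s := (L : Set H)) (fun y hy => ?_) hclosed hxL
  refine hsym.norm_le_of_mem_iSup_eigenspace Subtype.coe_injective ht ?_ hy
  intro i hi
  change Module.End.HasEigenvalue A.toLinearMap (f i) at hi
  change ‖f i‖ ≤ t
  have hre : (starRingEnd ℂ) (f i) = f i := hsym.conj_eigenvalue_eq_self hi
  obtain ⟨r, hr⟩ := Complex.conj_eq_iff_real.1 hre
  have hr0 : 0 ≤ r := by
    rw [hr] at hi
    exact eigenvalue_nonneg_of_nonneg hi fun x => hA.re_inner_nonneg_right x
  have hrt : r < t := by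
    by_contra h
    exact i.2 ⟨r, not_lt.1 h⟩ hr
  rw [hr, Complex.norm_real, Real.norm_of_nonneg hr0]
  exact hrt.le

/-- An operator which is arbitrarily small on subspaces of finite codimension is compact. -/
theorem ContinuousLinearMap.isCompactOperator_of_forall_exists_ker {A : H →L[ℂ] H}
    (h : ∀ ε : ℝ, 0 < ε → ∃ (n : ℕ) (Φ : H →ₗ[ℂ] (Fin n → ℂ)),
      ∀ x ∈ LinearMap.ker Φ, ‖A x‖ ≤ ε * ‖x‖) : IsCompactOperator A := by
  have key : ∀ ε : ℝ, 0 < ε → ∃ B : H →L[ℂ] H, IsCompactOperator B ∧ ‖A - B‖ ≤ ε := by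
    intro ε hε
    obtain ⟨n, Φ, hΦ⟩ := h ε hε
    set V := LinearMap.ker Φ with hV
    -- `Φ` is injective on `Vᗮ`, since `V` and `Vᗮ` meet only in 0.
    have hfin : FiniteDimensional ℂ Vᗮ := by
      refine FiniteDimensional.of_injective (Φ.comp Vᗮ.subtype) ?_
      rw [← LinearMap.ker_eq_bot, eq_bot_iff]
      intro x hx
      have h1 : (x : H) ∈ V := hx
      exact Subtype.ext (inner_self_eq_zero.1 ((Submodule.mem_orthogonal V _).1 x.2 _ h1))
    refine ⟨A ∘L Vᗮ.starProjection, ?_, ?_⟩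
    · have h2 : IsCompactOperator (A ∘L Vᗮ.subtypeL) :=
        isCompactOperator_of_locallyCompactSpace_rng _
      exact h2.comp_clm Vᗮ.orthogonalProjectionOnto
    · refine ContinuousLinearMap.opNorm_le_bound _ hε.le fun x => ?_
      have hclosed : IsClosed {x : H | ‖A x‖ ≤ ε * ‖x‖} :=
        isClosed_le (by fun_prop) (by fun_prop)
      -- `Φ` is not assumed continuous, so `V` may fail to be closed; the estimate passes to its
      -- closure.
      have hmem : x - Vᗮ.starProjection x ∈ V.topologicalClosure := by
        rw [← Submodule.orthogonal_orthogonal_eq_closure]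
        exact Vᗮ.sub_starProjection_mem_orthogonal x
      have h3 : ‖A (x - Vᗮ.starProjection x)‖ ≤ ε * ‖x - Vᗮ.starProjection x‖ :=
        closure_minimal (s := (V : Set H)) (fun y hy => hΦ y hy) hclosed hmem
      have h4 : ‖x - Vᗮ.starProjection x‖ ≤ ‖x‖ := by
        rw [← Submodule.starProjection_orthogonal_val]
        exact Submodule.norm_starProjection_apply_le _ x
      calc ‖(A - A ∘L Vᗮ.starProjection) x‖ = ‖A (x - Vᗮ.starProjection x)‖ := by simp
        _ ≤ ε * ‖x - Vᗮ.starProjection x‖ := h3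
        _ ≤ ε * ‖x‖ := by gcongr
  refine isClosed_setOfPred_isCompactOperator.closure_subset ?_
  rw [Metric.mem_closure_iff]
  intro ε hε
  obtain ⟨B, hB, hAB⟩ := key (ε / 2) (by positivity)
  exact ⟨B, hB, by rw [dist_eq_norm]; linarith⟩

theorem isPositive_sqrt_star_mul_self (T : H →L[ℂ] H) : (CFC.sqrt (star T * T)).IsPositive :=
  (ContinuousLinearMap.nonneg_iff_isPositive _).1 (CFC.sqrt_nonneg _)

/-- Both squares equal `⟪x, T* T x⟫`. Hence estimates on `T` itself suffice to control its singular
values. -/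
theorem norm_sqrt_star_mul_self_apply (T : H →L[ℂ] H) (x : H) :
    ‖CFC.sqrt (star T * T) x‖ = ‖T x‖ := by
  set A := CFC.sqrt (star T * T) with hA
  have hsq : A * A = star T * T := CFC.sqrt_mul_sqrt_self _ (star_mul_self_nonneg T)
  have hsym : A.toLinearMap.IsSymmetric := (isPositive_sqrt_star_mul_self T).isSymmetric
  have h1 : inner ℂ (A x) (A x) = inner ℂ (T x) (T x) := by
    have h2 : inner ℂ (A x) (A x) = inner ℂ x ((A * A) x) := hsym x (A x)
    rw [h2, hsq]
    exact ContinuousLinearMap.adjoint_inner_right T x (T x)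
  rw [@norm_eq_sqrt_re_inner ℂ, h1, ← @norm_eq_sqrt_re_inner ℂ]

/-- If `‖T x‖ ≤ ε ‖x‖` on a subspace of codimension at most `m`, then at most `m` singular values
of `T` exceed `ε`. -/
theorem singularValueCount_le_of_ker {T : H →L[ℂ] H} {ε r : ℝ} (hε : 0 ≤ ε) (hεr : ε < 1 / r)
    {Y : Type*} [AddCommGroup Y] [Module ℂ Y] [FiniteDimensional ℂ Y] (Φ : H →ₗ[ℂ] Y)
    (hΦ : ∀ x ∈ LinearMap.ker Φ, ‖T x‖ ≤ ε * ‖x‖) :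
    singularValueCount T r ≤ Module.finrank ℂ Y := by
  have hsub : {j : ℕ | 1 / r ≤ singularValue T j} ⊆ Iio (Module.finrank ℂ Y) := by
    intro j hj
    by_contra hjm
    have hjm' : Module.finrank ℂ Y ≤ j := not_lt.1 hjm
    have : singularValue T j ≤ ε := by
      -- The supremum may be over the empty set, where it is 0; this is covered by `0 ≤ ε`. For `t >
      -- ε`, the spectral subspace `U` meets the kernel of `Φ` trivially, so its rank is at most
      -- `dim Y ≤ j`.
      refine Real.sSup_le ?_ hε
      rintro t ⟨ht, hjt⟩
      by_contra! htε
      refine absurd hjt (not_lt.2 ?_)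
      set U := ⨆ s : Ici t, Module.End.eigenspace
        (CFC.sqrt (star T * T)).toLinearMap ((s : ℝ) : ℂ) with hU
      have hinj : Function.Injective (Φ.comp U.subtype) := by
        rw [← LinearMap.ker_eq_bot, eq_bot_iff]
        intro x hx
        have h1 : ‖T x‖ ≤ ε * ‖(x : H)‖ := hΦ _ hx
        have h2 : t * ‖(x : H)‖ ≤ ‖CFC.sqrt (star T * T) x‖ :=
          (isPositive_sqrt_star_mul_self T).isSymmetric.mul_norm_le_of_mem_iSup_eigenspace
            ht.le x.2
        rw [norm_sqrt_star_mul_self_apply] at h2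
        have h3 : (t - ε) * ‖(x : H)‖ ≤ 0 := by linarith
        have h4 : ‖(x : H)‖ ≤ 0 := by
          by_contra! h5
          have := mul_pos (sub_pos.2 htε) h5
          linarith
        exact Subtype.ext (norm_le_zero_iff.1 h4)
      have := (Φ.comp U.subtype).lift_rank_le_of_injective hinj
      rw [← Module.finrank_eq_rank ℂ Y, Cardinal.lift_natCast] at this
      have h6 : Cardinal.lift (Module.rank ℂ U) ≤ (j : Cardinal) :=
        this.trans (by exact_mod_cast hjm')
      exact Cardinal.lift_le_nat_iff.1 h6
    have hj' : 1 / r ≤ singularValue T j := hj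
    linarith
  refine (Set.encard_le_encard hsub).trans_eq ?_
  rw [← Finset.coe_Iio, Set.encard_coe_eq_coe_finsetCard, Nat.card_Iio]

/-- If `T` is arbitrarily small on subspaces of finite codimension and bounded below by `c` on a subspace of dimension `m`, then at least
`m` singular values of `T` are at least `1 / r`, for each `1 / r < c`. -/
theorem le_singularValueCount {T : H →L[ℂ] H}
    (hT : ∀ ε : ℝ, 0 < ε → ∃ (n : ℕ) (Φ : H →ₗ[ℂ] (Fin n → ℂ)),
      ∀ x ∈ LinearMap.ker Φ, ‖T x‖ ≤ ε * ‖x‖)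
    {c r : ℝ} (hr : 0 < r) (hrc : 1 / r < c)
    {Y : Type*} [AddCommGroup Y] [Module ℂ Y] [FiniteDimensional ℂ Y] (ι : Y →ₗ[ℂ] H)
    (hinj : Function.Injective ι) (hι : ∀ y, c * ‖ι y‖ ≤ ‖T (ι y)‖) :
    (Module.finrank ℂ Y : ℕ∞) ≤ singularValueCount T r := by
  have hr' : 0 < 1 / r := by positivity
  have hcomp : IsCompactOperator (CFC.sqrt (star T * T) : H →L[ℂ] H) :=
    ContinuousLinearMap.isCompactOperator_of_forall_exists_ker fun ε hε => by
      simpa only [norm_sqrt_star_mul_self_apply] using hT ε hε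
  have hsub : Iio (Module.finrank ℂ Y) ⊆ {j : ℕ | 1 / r ≤ singularValue T j} := by
    intro j hj
    -- A real supremum is informative only for a bounded set; here the operator norm is an upper
    -- bound.
    refine le_csSup ⟨‖CFC.sqrt (star T * T)‖, ?_⟩ ⟨hr', ?_⟩
    · rintro t ⟨ht, hjt⟩
      set U := ⨆ s : Ici t, Module.End.eigenspace
        (CFC.sqrt (star T * T)).toLinearMap ((s : ℝ) : ℂ) with hU
      have hne : U ≠ ⊥ := by
        intro h0
        rw [h0, rank_bot] at hjt
        exact absurd hjt (not_lt.2 (Nat.cast_nonneg j))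
      obtain ⟨x, hx, hx0⟩ := U.exists_mem_ne_zero_of_ne_bot hne
      have h2 : t * ‖x‖ ≤ ‖CFC.sqrt (star T * T) x‖ :=
        (isPositive_sqrt_star_mul_self T).isSymmetric.mul_norm_le_of_mem_iSup_eigenspace ht.le hx
      exact le_of_mul_le_mul_right (h2.trans (ContinuousLinearMap.le_opNorm _ _))
        (norm_pos_iff.2 hx0)
    · by_contra! hrank
      set U := ⨆ s : Ici (1 / r), Module.End.eigenspace
        (CFC.sqrt (star T * T)).toLinearMap ((s : ℝ) : ℂ) with hU
      have hfin : FiniteDimensional ℂ U :=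
        Module.rank_lt_aleph0_iff.1 (hrank.trans_lt Cardinal.natCast_lt_aleph0)
      rw [← Module.finrank_eq_rank ℂ U, Nat.cast_le] at hrank
      -- Were `dim U ≤ j < dim Y`, some nonzero `ι y` would be orthogonal to `U`, whence `‖T (ι y)‖
      -- ≤ (1 / r) ‖ι y‖`, against the lower bound `c`.
      set P : Y →ₗ[ℂ] U := U.orthogonalProjectionOnto.toLinearMap.comp ι with hP
      have hker : LinearMap.ker P ≠ ⊥ :=
        LinearMap.ker_ne_bot_of_finrank_lt (hrank.trans_lt hj)
      obtain ⟨y, hy, hy0⟩ := (LinearMap.ker P).exists_mem_ne_zero_of_ne_bot hker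
      have hyU : ι y ∈ Uᗮ := U.orthogonalProjectionOnto_eq_zero_iff.1 hy
      have h1 := (isPositive_sqrt_star_mul_self T).norm_le_of_mem_orthogonal hcomp hr'.le hyU
      rw [norm_sqrt_star_mul_self_apply] at h1
      have hpos : 0 < ‖ι y‖ := norm_pos_iff.2 fun h => hy0 (hinj (by rw [h, map_zero]))
      have h2 := hι y
      have h3 : 1 / r * ‖ι y‖ < c * ‖ι y‖ := by gcongr
      linarith
  refine Eq.trans_le ?_ (Set.encard_le_encard hsub)
  rw [← Finset.coe_Iio, Set.encard_coe_eq_coe_finsetCard, Nat.card_Iio]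

end SpectralTools

/-! ### Bergman space estimates uniform in the space of values -/

namespace BergmanSpace

variable {Ω : TopologicalSpace.Opens ℂ} {E E' : Type*} [NormedAddCommGroup E]
  [InnerProductSpace ℂ E] [NormedAddCommGroup E'] [InnerProductSpace ℂ E']

theorem norm_le_of_forall_norm_le {F : BergmanSpace Ω E} {K : BergmanSpace Ω E'} {c : ℝ}
    (hc : 0 ≤ c) (h : ∀ z ∈ Ω, ‖F z‖ ≤ c * ‖K z‖) : ‖F‖ ≤ c * ‖K‖ := by
  rw [norm_eq, norm_eq, ← ENNReal.toReal_ofReal hc, ← ENNReal.toReal_mul]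
  refine ENNReal.toReal_mono (ENNReal.mul_ne_top ENNReal.ofReal_ne_top K.memLp.2.ne) ?_
  exact eLpNorm_le_mul_eLpNorm_of_ae_le_mul
    ((ae_restrict_iff' Ω.isOpen.measurableSet).2 (Eventually.of_forall h)) 2

theorem norm_le_of_forall_norm_le_const {F : BergmanSpace Ω E} {c : ℝ} (hc : 0 ≤ c)
    (hΩ : volume (Ω : Set ℂ) < ∞) (h : ∀ z ∈ Ω, ‖F z‖ ≤ c) :
    ‖F‖ ≤ (volume (Ω : Set ℂ) ^ (2 : ℝ≥0∞).toReal⁻¹).toReal * c := by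
  have hv : volume (Ω : Set ℂ) ^ (2 : ℝ≥0∞).toReal⁻¹ ≠ ∞ :=
    ENNReal.rpow_ne_top_of_nonneg (by positivity) hΩ.ne
  have h1 := eLpNorm_le_of_ae_bound (p := 2) (f := F) (μ := volume.restrict (Ω : Set ℂ))
    ((ae_restrict_iff' Ω.isOpen.measurableSet).2 (Eventually.of_forall h))
  rw [Measure.restrict_apply_univ] at h1
  rw [norm_eq]
  refine (ENNReal.toReal_mono (ENNReal.mul_ne_top hv ENNReal.ofReal_ne_top) h1).trans_eq ?_
  rw [ENNReal.toReal_mul, ENNReal.toReal_ofReal hc]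

/-- Postcomposition with a bounded linear map. -/
noncomputable def postcomp (L : E →L[ℂ] E') (F : BergmanSpace Ω E) : BergmanSpace Ω E' :=
  ⟨fun z => L (F z), L.differentiable.comp_differentiableOn F.differentiableOn,
    L.comp_memLp' F.memLp, fun z hz => (congrArg L (F.2.2.2 z hz)).trans (map_zero L)⟩

theorem norm_postcomp_le (L : E →L[ℂ] E') (F : BergmanSpace Ω E) :
    ‖postcomp L F‖ ≤ ‖L‖ * ‖F‖ :=
  norm_le_of_forall_norm_le (norm_nonneg _) fun z _ => L.le_opNorm (F z)

/-- Point evaluations are bounded, locally uniformly on `Ω`, with bounds that do not depend on the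
space of values. -/
theorem exists_bound_forall {K : Set ℂ} (hK : IsCompact K) (hKΩ : K ⊆ Ω) :
    ∃ C : ℝ, 0 ≤ C ∧ ∀ (N : ℕ) (F : BergmanSpace Ω (EuclideanSpace ℂ (Fin N))), ∀ z ∈ K,
      ‖F z‖ ≤ C * ‖F‖ := by
  obtain ⟨C, hC0, hC⟩ := exists_bound (E := ℂ) hK hKΩ
  refine ⟨C, hC0, fun N F z hz => ?_⟩
  -- Pairing `F` with the fixed vector `F z` reduces to the scalar case, whose constant does not see
  -- `N`.
  have h1 := hC (postcomp (innerSL ℂ (F z)) F) z hz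
  have h2 : ‖postcomp (innerSL ℂ (F z)) F z‖ = ‖F z‖ * ‖F z‖ := by
    change ‖(inner ℂ (F z) (F z) : ℂ)‖ = _
    rw [inner_self_eq_norm_sq_to_K, norm_pow, sq]
    simp
  have h3 : ‖postcomp (innerSL ℂ (F z)) F‖ ≤ ‖F z‖ * ‖F‖ := by
    simpa using norm_postcomp_le (innerSL ℂ (F z)) F
  rw [h2] at h1
  rcases (norm_nonneg (F z)).eq_or_lt with h0 | h0
  · rw [← h0]; positivity
  · refine le_of_mul_le_mul_left (h1.trans ?_) h0
    calc C * ‖postcomp (innerSL ℂ (F z)) F‖ ≤ C * (‖F z‖ * ‖F‖) := by gcongr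
      _ = ‖F z‖ * (C * ‖F‖) := by ring

/-- Functions in the Bergman space are locally Lipschitz, with constants that do not depend on the
space of values. -/
theorem exists_lipschitz_forall {K : Set ℂ} (hK : IsCompact K) (hKΩ : K ⊆ Ω) :
    ∃ C : ℝ, 0 ≤ C ∧ ∃ δ : ℝ, 0 < δ ∧ ∀ (N : ℕ) (F : BergmanSpace Ω (EuclideanSpace ℂ (Fin N))),
      ∀ z ∈ K, ∀ w ∈ Metric.ball z δ, ‖F w - F z‖ ≤ C * ‖F‖ * dist w z := by
  obtain ⟨δ, hδ, hδK⟩ := hK.exists_cthickening_subset_open Ω.isOpen hKΩ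
  obtain ⟨C, hC0, hC⟩ := exists_bound_forall hK.cthickening hδK
  refine ⟨2 * C / δ, by positivity, δ, hδ, fun N F z hz w hw => ?_⟩
  have hball : Metric.ball z δ ⊆ Metric.cthickening δ K :=
    Metric.ball_subset_closedBall.trans (Metric.closedBall_subset_cthickening hz δ)
  have hz' : z ∈ Metric.cthickening δ K := hball (Metric.mem_ball_self hδ)
  -- Set-up for the Schwarz lemma, which turns this bound into a Lipschitz estimate at the centre.
  have hmaps : MapsTo F (Metric.ball z δ) (Metric.closedBall (F z) (2 * C * ‖F‖)) := by
    intro u hu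
    rw [Metric.mem_closedBall, dist_eq_norm]
    calc ‖F u - F z‖ ≤ ‖F u‖ + ‖F z‖ := norm_sub_le _ _
      _ ≤ C * ‖F‖ + C * ‖F‖ := add_le_add (hC N F u (hball hu)) (hC N F z hz')
      _ = 2 * C * ‖F‖ := by ring
  have := Complex.dist_le_div_mul_dist_of_mapsTo_ball
    (F.differentiableOn.mono (hball.trans hδK)) hmaps hw
  rw [dist_eq_norm] at this
  refine this.trans_eq ?_
  ring

/-- Evaluation at a family of points, as a linear map. -/
def evalLinearMap {ι : Type*} (p : ι → ℂ) : BergmanSpace Ω E →ₗ[ℂ] (ι → E) where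
  toFun F i := F (p i)
  map_add' _ _ := rfl
  map_smul' _ _ := rfl

/-- The function `z ↦ f z • u`, as a linear function of `u`. -/
noncomputable def smulConst (f : BergmanSpace Ω ℂ) : E →ₗ[ℂ] BergmanSpace Ω E where
  toFun u := postcomp (ContinuousLinearMap.toSpanSingleton ℂ u) f
  map_add' u v := by
    ext z hz
    exact smul_add (f z) u v
  map_smul' c u := by
    ext z hz
    exact smul_comm (f z) c u

theorem smulConst_apply (f : BergmanSpace Ω ℂ) (u : E) (z : ℂ) :
    smulConst f u z = f z • u := rfl

theorem norm_smulConst_le (f : BergmanSpace Ω ℂ) (u : E) : ‖smulConst f u‖ ≤ ‖u‖ * ‖f‖ :=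
  (norm_postcomp_le _ _).trans_eq (by rw [ContinuousLinearMap.norm_toSpanSingleton])

/-- A function which is holomorphic on `ℂ`, restricted to a bounded open set. -/
noncomputable def ofDifferentiable (hΩ : Bornology.IsBounded (Ω : Set ℂ)) {f : ℂ → ℂ}
    (hf : Differentiable ℂ f) : BergmanSpace Ω ℂ :=
  ⟨(Ω : Set ℂ).indicator f,
    hf.differentiableOn.congr fun z hz => indicator_of_mem hz _, by
    obtain ⟨C, hC⟩ := hΩ.isCompact_closure.exists_bound_of_continuousOn hf.continuous.continuousOn
    have hfin : IsFiniteMeasure (volume.restrict (Ω : Set ℂ)) :=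
      ⟨by rw [Measure.restrict_apply_univ]; exact hΩ.measure_lt_top⟩
    refine (memLp_congr_ae (indicator_ae_eq_restrict Ω.isOpen.measurableSet)).2
      (MemLp.of_bound hf.continuous.aestronglyMeasurable C ?_)
    exact (ae_restrict_iff' Ω.isOpen.measurableSet).2
      (Eventually.of_forall fun z hz => hC z (subset_closure hz)),
    fun z hz => indicator_of_notMem hz _⟩

theorem ofDifferentiable_apply (hΩ : Bornology.IsBounded (Ω : Set ℂ)) {f : ℂ → ℂ}
    (hf : Differentiable ℂ f) {z : ℂ} (hz : z ∈ Ω) : ofDifferentiable hΩ hf z = f z :=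
  indicator_of_mem (s := (Ω : Set ℂ)) hz f

end BergmanSpace

/-! ### Permutation matrices and the upper bound -/

theorem toEuclideanCLM_permMatrix_apply {N : ℕ} (σ : Equiv.Perm (Fin N))
    (v : EuclideanSpace ℂ (Fin N)) (i : Fin N) :
    Matrix.toEuclideanCLM (𝕜 := ℂ) (σ.permMatrix ℂ) v i = v (σ i) := by
  rw [Matrix.ofLp_toEuclideanCLM, Matrix.permMatrix_mulVec]
  rfl

theorem norm_toEuclideanCLM_permMatrix {N : ℕ} (σ : Equiv.Perm (Fin N))
    (v : EuclideanSpace ℂ (Fin N)) :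
    ‖Matrix.toEuclideanCLM (𝕜 := ℂ) (σ.permMatrix ℂ) v‖ = ‖v‖ := by
  rw [EuclideanSpace.norm_eq, EuclideanSpace.norm_eq]
  congr 1
  simp only [toEuclideanCLM_permMatrix_apply]
  exact Equiv.sum_comp σ fun i => ‖v i‖ ^ 2

namespace TransferSystem

variable {d : ℕ} (S : TransferSystem d)

theorem isCompact_iUnion_closure_image :
    IsCompact (⋃ j, closure (S.γ j '' (S.Ω : Set ℂ))) :=
  isCompact_iUnion S.isCompact_closure_image

theorem iUnion_closure_image_subset : (⋃ j, closure (S.γ j '' (S.Ω : Set ℂ))) ⊆ S.Ω :=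
  iUnion_subset S.closure_image_subset

/-- For each `ε > 0` the operator `ℒ_N` has norm at most `ε` on the functions which vanish on some
finite subset of `Ω`, which does not depend on `N`. -/
theorem exists_eval_norm_le {ε : ℝ} (hε : 0 < ε) :
    ∃ (m : ℕ) (p : Fin m → ℂ), ∀ (N : ℕ) (σ : Fin d → Equiv.Perm (Fin N)) (F : S.Hilb N),
      F ∈ LinearMap.ker (BergmanSpace.evalLinearMap p) →
        ‖S.transferOperator σ F‖ ≤ ε * ‖F‖ := by
  set K := ⋃ j, closure (S.γ j '' (S.Ω : Set ℂ)) with hK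
  have hKc : IsCompact K := S.isCompact_iUnion_closure_image
  have hKΩ : K ⊆ S.Ω := S.iUnion_closure_image_subset
  obtain ⟨C, hC0, δ, hδ, hC⟩ := BergmanSpace.exists_lipschitz_forall hKc hKΩ
  obtain ⟨M, hM⟩ := hKc.exists_bound_of_continuousOn
    ((S.G_diffContOnCl.differentiableOn.continuousOn.mono hKΩ).cexp)
  set v := (volume (S.Ω : Set ℂ) ^ (2 : ℝ≥0∞).toReal⁻¹).toReal with hv
  have hv0 : 0 ≤ v := ENNReal.toReal_nonneg
  set D := v * (d * (|M| * C)) with hD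
  have hD0 : 0 ≤ D := by positivity
  -- The final estimate is `D * η * ‖F‖`; the `+ 1` avoids division by zero, and `η ≤ δ` keeps the
  -- Lipschitz bound valid. Neither `η` nor the net below depends on `N`.
  set η := min δ (ε / (D + 1)) with hη
  have hη0 : 0 < η := lt_min hδ (by positivity)
  obtain ⟨t, htK, htfin, ht⟩ := hKc.finite_cover_balls hη0
  obtain ⟨m, p, -, hp⟩ := htfin.fin_param
  refine ⟨m, p, fun N σ F hF => ?_⟩
  have hF0 : ∀ w ∈ t, F w = 0 := by
    intro w hw
    rw [← hp] at hw
    obtain ⟨i, rfl⟩ := hw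
    exact congrFun hF i
  have hsmall : ∀ z ∈ K, ‖F z‖ ≤ C * ‖F‖ * η := by
    intro z hz
    obtain ⟨w, hw, hzw⟩ := mem_iUnion₂.1 (ht hz)
    have h1 := hC N F w (htK hw) z (Metric.ball_subset_ball (min_le_left _ _) hzw)
    rw [hF0 w hw, sub_zero] at h1
    refine h1.trans ?_
    gcongr
    exact (Metric.mem_ball.1 hzw).le
  have hbound : ∀ z ∈ S.Ω, ‖S.transferOperator σ F z‖ ≤ d * (|M| * (C * ‖F‖ * η)) := by
    intro z hz
    rw [S.transferOperator_apply σ F hz]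
    have hsum : ∑ _j : Fin d, |M| * (C * ‖F‖ * η) = d * (|M| * (C * ‖F‖ * η)) := by simp
    rw [← hsum]
    refine norm_sum_le_of_le _ fun j _ => ?_
    have hz' : S.γ j z ∈ K := mem_iUnion.2 ⟨j, subset_closure (mem_image_of_mem _ hz)⟩
    rw [norm_smul, norm_toEuclideanCLM_permMatrix]
    exact mul_le_mul ((hM _ hz').trans (le_abs_self _)) (hsmall _ hz') (norm_nonneg _)
      (abs_nonneg _)
  calc ‖S.transferOperator σ F‖ ≤ v * (d * (|M| * (C * ‖F‖ * η))) :=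
        BergmanSpace.norm_le_of_forall_norm_le_const (by positivity) S.volume_lt_top hbound
    _ = D * η * ‖F‖ := by rw [hD]; ring
    _ ≤ ε * ‖F‖ := by
        gcongr
        calc D * η ≤ (D + 1) * (ε / (D + 1)) :=
              mul_le_mul (by linarith) (min_le_right _ _) hη0.le (by positivity)
          _ = ε := by field_simp

/-- For each `r > 0`, at most `O(N)` singular values of `ℒ_N` are at least `1 / r`. -/
theorem exists_singularValueCount_le {r : ℝ} (hr : 0 < r) :
    ∃ m : ℕ, ∀ (N : ℕ) (σ : Fin d → Equiv.Perm (Fin N)),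
      singularValueCount (S.transferOperator σ) r ≤ (m * N : ℕ) := by
  obtain ⟨m, p, hp⟩ := S.exists_eval_norm_le (ε := 1 / r / 2) (by positivity)
  refine ⟨m, fun N σ => ?_⟩
  have h := singularValueCount_le_of_ker (T := S.transferOperator σ) (r := r) (ε := 1 / r / 2)
    (by positivity) (half_lt_self (by positivity)) (BergmanSpace.evalLinearMap p) (fun F hF => hp N σ F hF)
  have h2 : Module.finrank ℂ (Fin m → EuclideanSpace ℂ (Fin N)) = m * N := by
    rw [Module.finrank_pi_fintype, Finset.sum_const, finrank_euclideanSpace_fin, Finset.card_univ,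
      Fintype.card_fin, smul_eq_mul]
  rw [h2] at h
  exact h

/-- The form of compactness that `le_singularValueCount` requires; here the codimension bound `n`
may depend on `N`. -/
theorem exists_ker_norm_le {N : ℕ} (σ : Fin d → Equiv.Perm (Fin N)) (ε : ℝ) (hε : 0 < ε) :
    ∃ (n : ℕ) (Φ : S.Hilb N →ₗ[ℂ] (Fin n → ℂ)),
      ∀ x ∈ LinearMap.ker Φ, ‖S.transferOperator σ x‖ ≤ ε * ‖x‖ := by
  obtain ⟨m, p, hp⟩ := S.exists_eval_norm_le hε
  have e := LinearEquiv.ofFinrankEq (R := ℂ) (Fin m → EuclideanSpace ℂ (Fin N))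
    (Fin (Module.finrank ℂ (Fin m → EuclideanSpace ℂ (Fin N))) → ℂ)
    (Module.finrank_fin_fun ℂ).symm
  refine ⟨_, e.toLinearMap.comp (BergmanSpace.evalLinearMap p), fun F hF => ?_⟩
  rw [LinearEquiv.ker_comp] at hF
  exact hp N σ F hF

end TransferSystem

/-! ### Letters with disjoint images, and vectors without cancellation -/

/-- Given `d ≥ 1` permutations of `N` letters, there are at least `N / d²` letters whose sets of images
under the permutations are pairwise disjoint. -/
theorem exists_finset_disjoint_images {d N : ℕ} (hd : 0 < d) (σ : Fin d → Equiv.Perm (Fin N)) :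
    ∃ I : Finset (Fin N), N ≤ I.card * (d * d) ∧
      ∀ i ∈ I, ∀ k ∈ I, ∀ j l, σ j i = σ l k → i = k := by
  classical
  set P : Finset (Finset (Fin N)) := Finset.univ.filter fun I =>
    ∀ i ∈ I, ∀ k ∈ I, ∀ j l, σ j i = σ l k → i = k with hP
  obtain ⟨I, hIP, hmax⟩ := P.exists_max_image Finset.card ⟨∅, by simp [hP]⟩
  have hI : ∀ i ∈ I, ∀ k ∈ I, ∀ j l, σ j i = σ l k → i = k := by simpa [hP] using hIP
  refine ⟨I, ?_, hI⟩
  -- By maximality, a letter sharing no image with `I` could be added to it. So each `k` is `σ_l⁻¹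
  -- σ_j i` for some `i ∈ I`, which leaves at most `|I| d²` letters.
  have hcover : ∀ k, ∃ i ∈ I, ∃ j l, σ j i = σ l k := by
    intro k
    by_cases hk : k ∈ I
    · exact ⟨k, hk, ⟨0, hd⟩, ⟨0, hd⟩, rfl⟩
    by_contra! h
    have hins : insert k I ∈ P := by
      simp only [hP, Finset.mem_filter, Finset.mem_univ, true_and, Finset.mem_insert]
      rintro i (rfl | hi) m (rfl | hm) j l hjl
      · rfl
      · exact absurd hjl.symm (h m hm l j)
      · exact absurd hjl (h i hi j l)
      · exact hI i hi m hm j l hjl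
    have := hmax _ hins
    rw [Finset.card_insert_of_notMem hk] at this
    omega
  have hsub : (Finset.univ : Finset (Fin N)) ⊆
      (I ×ˢ (Finset.univ : Finset (Fin d × Fin d))).image
        fun q => (σ q.2.2).symm (σ q.2.1 q.1) := by
    intro k _
    obtain ⟨i, hi, j, l, h⟩ := hcover k
    refine Finset.mem_image.2 ⟨(i, (j, l)), by simp [hi], ?_⟩
    simp [h]
  have := (Finset.card_le_card hsub).trans Finset.card_image_le
  simpa [Finset.card_product] using this

/-- Transport of functions on `I` to functions supported on the image of `I` under a permutation. -/
noncomputable def extendPerm {N : ℕ} (I : Finset (Fin N)) (τ : Equiv.Perm (Fin N)) :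
    (I → ℂ) →ₗ[ℂ] EuclideanSpace ℂ (Fin N) where
  toFun y := WithLp.toLp 2 fun k => if h : τ.symm k ∈ I then y ⟨τ.symm k, h⟩ else 0
  map_add' x y := by
    ext k
    by_cases h : τ.symm k ∈ I <;> simp [h]
  map_smul' c y := by
    ext k
    by_cases h : τ.symm k ∈ I <;> simp [h]

theorem extendPerm_apply_of_mem {N : ℕ} {I : Finset (Fin N)} {τ : Equiv.Perm (Fin N)} (y : I → ℂ)
    {i k : Fin N} (hi : i ∈ I) (hk : τ i = k) : extendPerm I τ y k = y ⟨i, hi⟩ := by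
  subst hk
  simp [extendPerm, hi]

theorem extendPerm_apply_of_notMem {N : ℕ} {I : Finset (Fin N)} {τ : Equiv.Perm (Fin N)}
    (y : I → ℂ) {k : Fin N} (hk : ∀ i ∈ I, τ i ≠ k) : extendPerm I τ y k = 0 := by
  have : τ.symm k ∉ I := fun h => hk _ h (by simp)
  simp [extendPerm, this]

theorem extendPerm_injective {N : ℕ} (I : Finset (Fin N)) (τ : Equiv.Perm (Fin N)) :
    Function.Injective (extendPerm I τ) := by
  intro x y h
  funext i
  rw [← extendPerm_apply_of_mem (τ := τ) x i.2 rfl, h, extendPerm_apply_of_mem y i.2 rfl]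

/-- A sum of permutation matrices does not decrease the norm of vectors supported on the image of
a set of letters with disjoint orbits. -/
theorem norm_extendPerm_le {d N : ℕ} {σ : Fin d → Equiv.Perm (Fin N)} {I : Finset (Fin N)}
    (hI : ∀ i ∈ I, ∀ k ∈ I, ∀ j l, σ j i = σ l k → i = k) {J : Finset (Fin d)} {j₀ : Fin d}
    (hj₀ : j₀ ∈ J) (y : I → ℂ) {a : ℂ} {w : EuclideanSpace ℂ (Fin N)}
    (hw : ∀ i, w i = a * ∑ j ∈ J, extendPerm I (σ j₀) y (σ j i)) :
    ‖a‖ * ‖extendPerm I (σ j₀) y‖ ≤ ‖w‖ := by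
  classical
  refine le_of_sq_le_sq ?_ (norm_nonneg _)
  rw [mul_pow, EuclideanSpace.norm_sq_eq, EuclideanSpace.norm_sq_eq,
    ← Equiv.sum_comp (σ j₀), Finset.mul_sum]
  refine Finset.sum_le_sum fun i _ => ?_
  rw [hw, norm_mul, mul_pow]
  gcongr
  by_cases hi : i ∈ I
  · rw [extendPerm_apply_of_mem y hi rfl]
    -- By disjointness, `σ j i` can lie in `σ j₀ (I)` only as `σ j₀ i`. The sum is thus `y i` times
    -- the number of `j ∈ J` with `σ j i = σ j₀ i`, a count that includes `j₀`.
    have hterm : ∀ j ∈ J, extendPerm I (σ j₀) y (σ j i) =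
        if σ j i = σ j₀ i then y ⟨i, hi⟩ else 0 := by
      intro j _
      split_ifs with h
      · exact extendPerm_apply_of_mem y hi h.symm
      · refine extendPerm_apply_of_notMem y fun k hk hki => h ?_
        rw [hI k hk i hi _ _ hki] at hki
        exact hki.symm
    rw [Finset.sum_congr rfl hterm, ← Finset.sum_filter, Finset.sum_const, nsmul_eq_mul, norm_mul,
      Complex.norm_natCast]
    refine le_mul_of_one_le_left (norm_nonneg _) ?_
    have : 0 < (J.filter fun j => σ j i = σ j₀ i).card :=
      Finset.card_pos.2 ⟨j₀, by simp [hj₀]⟩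
    exact_mod_cast this
  · rw [extendPerm_apply_of_notMem y fun k hk hki => hi ?_]
    · simp
    · rwa [← (σ j₀).injective hki]

/-! ### The lower bound -/

namespace TransferSystem

variable {d : ℕ} (S : TransferSystem d)

/-- There is a test function `f` for which the value of `ℒ_N (f u)` at some point is a nonzero
multiple of a sum of permutation matrices applied to `u`. -/
theorem exists_testFunction (j₀ : Fin d) :
    ∃ (f : BergmanSpace S.Ω ℂ) (a : ℂ) (J : Finset (Fin d)) (z : ℂ), a ≠ 0 ∧ j₀ ∈ J ∧ z ∈ S.Ω ∧
      ∀ (N : ℕ) (σ : Fin d → Equiv.Perm (Fin N)) (u : EuclideanSpace ℂ (Fin N)) (i : Fin N),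
        S.transferOperator σ (BergmanSpace.smulConst f u) z i = a * ∑ j ∈ J, u (σ j i) := by
  classical
  obtain ⟨z, hz⟩ : (S.Ω : Set ℂ).Nonempty := S.isSimplyConnected.isPathConnected.nonempty
  set w : Fin d → ℂ := fun j => S.γ j z with hw
  -- Lagrange interpolation. The points `w j` may coincide, so `g` cannot isolate `j₀` itself, only
  -- the set `J` of indices with `w j = w j₀`.
  set g : ℂ → ℂ := fun x => ∏ j with w j ≠ w j₀, (x - w j) / (w j₀ - w j) with hg
  have hgd : Differentiable ℂ g := by
    rw [hg]
    fun_prop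
  have hg1 : g (w j₀) = 1 := by
    refine Finset.prod_eq_one fun j hj => div_self (sub_ne_zero.2 ?_)
    exact (Finset.mem_filter.1 hj).2.symm
  have hg0 : ∀ j, w j ≠ w j₀ → g (w j) = 0 := fun j hj =>
    Finset.prod_eq_zero (Finset.mem_filter.2 ⟨Finset.mem_univ j, hj⟩) (by simp)
  refine ⟨BergmanSpace.ofDifferentiable S.isBounded hgd, Complex.exp (S.G (w j₀)),
    Finset.univ.filter fun j => w j = w j₀, z, Complex.exp_ne_zero _, by simp, hz,
    fun N σ u i => ?_⟩
  rw [S.transferOperator_apply σ _ hz, WithLp.ofLp_sum, Finset.sum_apply, Finset.sum_filter,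
    Finset.mul_sum]
  refine Finset.sum_congr rfl fun j _ => ?_
  rw [BergmanSpace.smulConst_apply,
    BergmanSpace.ofDifferentiable_apply S.isBounded hgd (S.mapsTo j hz), map_smul]
  simp only [PiLp.smul_apply, toEuclideanCLM_permMatrix_apply, smul_eq_mul]
  change Complex.exp (S.G (w j)) * (g (w j) * _) = _
  by_cases h : w j = w j₀
  · simp [h, hg1]
  · simp [h, hg0 j h]

/-- For some `r > 0`, at least `N / d²` singular values of `ℒ_N` are at least `1 / r`, for all
choices of the permutations. -/
theorem exists_le_singularValueCount (hd : 0 < d) :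
    ∃ r : ℝ, 0 < r ∧ ∀ (N : ℕ) (σ : Fin d → Equiv.Perm (Fin N)), ∃ n : ℕ, N ≤ n * (d * d) ∧
      (n : ℕ∞) ≤ singularValueCount (S.transferOperator σ) r := by
  obtain ⟨f, a, J, z, ha, hJ, hz, hf⟩ := S.exists_testFunction ⟨0, hd⟩
  obtain ⟨C, hC0, hC⟩ := BergmanSpace.exists_bound_forall (Ω := S.Ω) (K := {z})
    isCompact_singleton (by simpa using hz)
  have ha' : 0 < ‖a‖ := norm_pos_iff.2 ha
  -- Here `C` bounds evaluation at `z` and `‖f‖` bounds `u ↦ f u`; each `+ 1` ensures positivity.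
  -- Below, `r = 2 / c` makes `1 / r = c / 2 < c`.
  set c := ‖a‖ / ((C + 1) * (‖f‖ + 1)) with hc
  have hc0 : 0 < c := by positivity
  refine ⟨2 / c, by positivity, fun N σ => ?_⟩
  obtain ⟨I, hIN, hI⟩ := exists_finset_disjoint_images hd σ
  refine ⟨I.card, hIN, ?_⟩
  set e := extendPerm I (σ ⟨0, hd⟩) with he
  have hlow : ∀ y, ‖a‖ * ‖e y‖ ≤
      (C + 1) * ‖S.transferOperator σ (BergmanSpace.smulConst f (e y))‖ := by
    intro y
    refine (norm_extendPerm_le hI hJ y (hf N σ (e y))).trans ((hC N _ z rfl).trans ?_)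
    gcongr
    linarith
  have hbd : ∀ y, c * ‖BergmanSpace.smulConst f (e y)‖ ≤
      ‖S.transferOperator σ (BergmanSpace.smulConst f (e y))‖ := by
    intro y
    have h1 := BergmanSpace.norm_smulConst_le f (e y)
    have h2 : c * ‖BergmanSpace.smulConst f (e y)‖ ≤ c * (‖e y‖ * (‖f‖ + 1)) := by
      gcongr
      refine h1.trans ?_
      gcongr
      linarith
    have h3 : c * (‖e y‖ * (‖f‖ + 1)) = ‖a‖ * ‖e y‖ / (C + 1) := by
      rw [hc]
      field_simp
    rw [h3] at h2
    refine h2.trans ((div_le_iff₀ (by positivity)).2 ?_)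
    exact (hlow y).trans_eq (mul_comm _ _)
  have hinj : Function.Injective ((BergmanSpace.smulConst f).comp e) := by
    refine (injective_iff_map_eq_zero _).2 fun y hy => ?_
    have h1 := hlow y
    have hy' : BergmanSpace.smulConst f (e y) = 0 := hy
    rw [hy', map_zero, norm_zero, mul_zero] at h1
    have h2 : ‖e y‖ ≤ 0 := by
      by_contra! h
      have := mul_pos ha' h
      linarith
    exact extendPerm_injective I _ ((norm_le_zero_iff.1 h2).trans (map_zero e).symm)
  have h := le_singularValueCount (T := S.transferOperator σ) (S.exists_ker_norm_le σ)
    (c := c) (r := 2 / c) (by positivity) (by rw [one_div_div]; linarith)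
    ((BergmanSpace.smulConst f).comp e) hinj hbd
  rwa [Module.finrank_fintype_fun_eq_card, Fintype.card_coe] at h

end TransferSystem

/-! ### Conclusion -/

theorem permProb_univ {d N : ℕ} : permProb (univ : Set (Fin d → Equiv.Perm (Fin N))) = 1 := by
  rw [permProb, Set.ncard_univ, Nat.card_eq_fintype_card]
  exact div_self (by exact_mod_cast Fintype.card_ne_zero)

theorem theorem1p2 {d : ℕ} (hd : 2 ≤ d) (S : TransferSystem d) :
    ∃ C₂ : ℝ, 0 < C₂ ∧ ∃ r₀ : ℝ, 0 < r₀ ∧ ∀ k : ℕ, ∃ A : ℝ, 0 < A ∧ ∀ N : ℕ, 1 ≤ N →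
      1 - A / (N : ℝ) ^ k ≤ permProb {σ : Fin d → Equiv.Perm (Fin N) |
        ENNReal.ofReal (C₂⁻¹ * N) ≤ (singularValueCount (S.transferOperator σ) r₀ : ℝ≥0∞) ∧
        (singularValueCount (S.transferOperator σ) r₀ : ℝ≥0∞) ≤ ENNReal.ofReal (C₂ * N)} := by
  -- The lower bound dictates `r`; the upper bound is available for any `r > 0`.
  obtain ⟨r, hr, hlow⟩ := S.exists_le_singularValueCount (by omega)
  obtain ⟨m, hm⟩ := S.exists_singularValueCount_le hr
  have hd0 : (0 : ℝ) < d * d := by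
    have : (0 : ℝ) < d := by exact_mod_cast (by omega : 0 < d)
    positivity
  -- `d * d + m` dominates both `d²` (lower bound) and `m` (upper bound). Since the event is
  -- certain, any positive `A` would do.
  refine ⟨d * d + m, by positivity, r, hr, fun k => ⟨1, one_pos, fun N hN => ?_⟩⟩
  have hall : {σ : Fin d → Equiv.Perm (Fin N) |
      ENNReal.ofReal ((d * d + m : ℝ)⁻¹ * N) ≤
        (singularValueCount (S.transferOperator σ) r : ℝ≥0∞) ∧
      (singularValueCount (S.transferOperator σ) r : ℝ≥0∞) ≤
        ENNReal.ofReal ((d * d + m : ℝ) * N)} = univ := by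
    refine eq_univ_of_forall fun σ => ⟨?_, ?_⟩
    · obtain ⟨n, hn, hn'⟩ := hlow N σ
      have h1 : ((n : ℕ∞) : ℝ≥0∞) ≤ (singularValueCount (S.transferOperator σ) r : ℝ≥0∞) :=
        ENat.toENNReal_le.2 hn'
      refine le_trans ?_ h1
      rw [ENat.toENNReal_coe, ← ENNReal.ofReal_natCast]
      refine ENNReal.ofReal_le_ofReal ?_
      rw [inv_mul_le_iff₀ (by positivity)]
      have hn2 : (N : ℝ) ≤ n * (d * d) := by exact_mod_cast hn
      have : (0 : ℝ) ≤ m * n := by positivity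
      linarith
    · have h1 : (singularValueCount (S.transferOperator σ) r : ℝ≥0∞) ≤
          (((m * N : ℕ) : ℕ∞) : ℝ≥0∞) := ENat.toENNReal_le.2 (hm N σ)
      refine h1.trans ?_
      rw [ENat.toENNReal_coe, ← ENNReal.ofReal_natCast]
      refine ENNReal.ofReal_le_ofReal ?_
      push_cast
      gcongr
      linarith
  rw [hall, permProb_univ]
  have : (0 : ℝ) ≤ 1 / (N : ℝ) ^ k := by positivity
  linarith
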